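/- Let $1\le k\le m\le n$ be integers. For positive $a_{ij}$, a random exponential $m\times n$ matrix with rate matrix $A=(a_{ij})$ is a random matrix $X=(x_{ij})$ with independent entries, $x_{ij}$ being exponentially distributed with rate $a_{ij}$ (density $a_{ij}e^{-a_{ij}x}$, $x\ge 0$). A $k$-assignment is a set of $k$ positions, no two in the same row or column; a minimum $k$-assignment of $X$ is one whose sum of entries is smallest, and $\min_k(X)$ is that smallest sum. For a $(k-1)\times(k-1)$ submatrix $M$ let $\chi_M(X)=1$ if $M$ contains a minimum $(k-1)$-assignment of $X$ and $\chi_M(X)=0$ otherwise. The expected contribution of $M$ to the minimum $k$-assignment is $E\big(\chi_M(X)\,\min_k(X)\big)$. The expected-contribution conjecture for $k$-assignments in $m\times n$ matrices is the assertion that for all positive reals $r_1,\dots,r_m$ and $c_1,\dots,c_n$, and all $(k-1)$-element sets $I\subseteq\{1,\dots,m\}$ and $J\subseteq\{1,\dots,n\}$, the expected contribution, for the rate matrix $(r_ic_j)$, of the submatrix with rows $I$ and columns $J$ equals $$\sum_{(i_1,\dots,i_{k-1}),\,(j_1,\dots,j_{k-1})}\left(\prod_{t=1}^{k-1}\frac{r_{i_t}c_{j_t}}{\left(R-\sum_{s=1}^{t-1}r_{i_s}\right)\left(C-\sum_{s=1}^{t-1}c_{j_s}\right)}\right)\sum_{t,u\ge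 0,\;t+u<k}\frac{1}{\left(R-\sum_{s=1}^{t}r_{i_s}\right)\left(C-\sum_{s=1}^{u}c_{j_s}\right)},$$ where the outer sum is over the orderings $(i_1,\dots,i_{k-1})$ of $I$ and $(j_1,\dots,j_{k-1})$ of $J$, and $R=\sum_i r_i$, $C=\sum_j c_j$. Theorem. (a) The expected-contribution conjecture holds for $k$-assignments in $m\times n$ matrices if and only if it holds for $k$-assignments in $k\times k$ matrices. (b) Let $A$ be any positive $m\times n$ matrix and $X$ a random exponential matrix with rate matrix $A$. Let $Y=(y_{ij})$ be the auxiliary $k\times k$ matrix with $y_{ij}=x_{ij}$, $y_{ik}=\min_{j'\ge k}x_{ij'}$, $y_{kj}=\min_{i'\ge k}x_{i'j}$ for $i,j\le k-1$, and $y_{kk}=\min_{i',j'\ge k}x_{i'j'}$. Let $B=(b_{ij})$ be the $k\times k$ matrix with $b_{ij}=a_{ij}$, $b_{ik}=\sum_{j'\ge k}a_{ij'}$, $b_{kj}=\sum_{i'\ge k}a_{i'j}$ for $i,j\le k-1$, and $b_{kk}=\sum_{i',j'\ge k}a_{i'j'}$. Then $Y$ is a random exponential matrix with rate matrix $B$,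 and the expected contribution of the leading $(k-1)\times(k-1)$ submatrix to the minimum $k$-assignment is the same for the rate matrix $A$ as for the rate matrix $B$. -/

import Mathlib

open MeasureTheory ProbabilityTheory

noncomputable section

namespace RandomAssignment

section Assignments

variable {ι κ : Type*}

/-- A `k`-assignment: a set of `k` positions, no two in the same row or column. -/
def IsAssignment (k : ℕ) (σ : Finset (ι × κ)) : Prop :=
  σ.card = k ∧ Set.InjOn Prod.fst (σ : Set (ι × κ)) ∧ Set.InjOn Prod.snd (σ : Set (ι × κ))

/-- `σ` is a minimum `k`-assignment of the matrix `X` (with entry `X (i, j)` in position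
`(i, j)`): a `k`-assignment whose sum of entries is as small as possible. -/
def IsMinAssignment (k : ℕ) (X : ι × κ → ℝ) (σ : Finset (ι × κ)) : Prop :=
  IsAssignment k σ ∧ ∀ τ : Finset (ι × κ), IsAssignment k τ → ∑ p ∈ σ, X p ≤ ∑ p ∈ τ, X p

/-- `min_k(X)`: the smallest sum of the entries of a `k`-assignment of `X`. -/
def minValue (k : ℕ) (X : ι × κ → ℝ) : ℝ :=
  sInf ((fun σ : Finset (ι × κ) => ∑ p ∈ σ, X p) '' {σ | IsAssignment k σ})

/-- The event that the submatrix with rows `I` and columns `J` contains a minimum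
`(k - 1)`-assignment of `X`; its indicator is `χ_M`. -/
def containsMin (k : ℕ) (I : Finset ι) (J : Finset κ) : Set (ι × κ → ℝ) :=
  {X | ∃ σ : Finset (ι × κ), IsMinAssignment (k - 1) X σ ∧ σ ⊆ I ×ˢ J}

/-- The random variable `χ_M(X) · min_k(X)`, where `M` has rows `I` and columns `J`. -/
def contribution (k : ℕ) (I : Finset ι) (J : Finset κ) (X : ι × κ → ℝ) : ℝ :=
  (containsMin k I J).indicator (fun _ => (1 : ℝ)) X * minValue k X

end Assignments

section Law

variable {ι κ : Type*} [Fintype ι] [Fintype κ]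

/-- The law of a random exponential matrix with rate matrix `A`: the entries are independent,
the entry in position `p` being exponentially distributed with rate `A p`. -/
def expMatrixLaw (A : ι × κ → ℝ) : Measure (ι × κ → ℝ) :=
  Measure.pi fun p => expMeasure (A p)

/-- The expected contribution of the submatrix with rows `I` and columns `J` to the minimum
`k`-assignment of a random exponential matrix with rate matrix `A`. -/
def expectedContribution (k : ℕ) (A : ι × κ → ℝ) (I : Finset ι) (J : Finset κ) : ℝ :=
  ∫ X, contribution k I J X ∂(expMatrixLaw A)

/-- `W - ∑_{s=1}^{t} w_{i_s}`, where `W` is the sum of all the weights; the sequence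
`i = (i_1, …, i_l)` is indexed from `0`, so `i_s` is `i (s - 1)`. -/
def remainingWeight (w : ι → ℝ) {l : ℕ} (i : Fin l → ι) (t : ℕ) : ℝ :=
  ∑ x, w x - ∑ s ∈ Finset.univ.filter (fun s : Fin l => (s : ℕ) < t), w (i s)

/-- The conjectured value of the expected contribution. The outer sums are over the orderings
of `I` and `J` (which have `k - 1` elements) as sequences `(i_1, …, i_{k-1})` and
`(j_1, …, j_{k-1})`. -/
def predictedContribution [DecidableEq ι] [DecidableEq κ] (k : ℕ) (r : ι → ℝ) (c : κ → ℝ)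
    (I : Finset ι) (J : Finset κ) : ℝ :=
  ∑ i : Fin (k - 1) ≃ I, ∑ j : Fin (k - 1) ≃ J,
    (∏ t : Fin (k - 1), r (i t) * c (j t) /
      (remainingWeight r (fun s => (i s : ι)) t * remainingWeight c (fun s => (j s : κ)) t)) *
    ∑ tu ∈ Finset.range k ×ˢ Finset.range k with tu.1 + tu.2 < k,
      1 / (remainingWeight r (fun s => (i s : ι)) tu.1 *
        remainingWeight c (fun s => (j s : κ)) tu.2)

end Law

/-- The expected-contribution conjecture for `k`-assignments in `m × n` matrices: for all
positive `r_1, …, r_m` and `c_1, …, c_n` and all `(k - 1) × (k - 1)` submatrices, the expected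
contribution for the rate matrix `(r_i c_j)` is the predicted one. -/
def ContributionConjecture (k m n : ℕ) : Prop :=
  ∀ (r : Fin m → ℝ) (c : Fin n → ℝ), (∀ i, 0 < r i) → (∀ j, 0 < c j) →
    ∀ (I : Finset (Fin m)) (J : Finset (Fin n)), I.card = k - 1 → J.card = k - 1 →
      expectedContribution k (fun p => r p.1 * c p.2) I J = predictedContribution k r c I J

/-- The first `k - 1` of `m` indices. -/
def leading (k m : ℕ) : Finset (Fin m) := Finset.univ.filter fun i => (i : ℕ) < k - 1

/-- The positions of an `m × n` matrix that are merged into position `q` of the auxiliary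
`k × k` matrix: an index `< k - 1` stays, and all indices `≥ k - 1` become the last one,
`k - 1` (indices start at `0`). -/
def mergedInto {k : ℕ} (m n : ℕ) (q : Fin k × Fin k) : Finset (Fin m × Fin n) :=
  Finset.univ.filter fun p =>
    min (p.1 : ℕ) (k - 1) = (q.1 : ℕ) ∧ min (p.2 : ℕ) (k - 1) = (q.2 : ℕ)

/-- The auxiliary `k × k` matrix of `X` for the leading `(k - 1) × (k - 1)` submatrix: to it are
appended the minima of the rest of each of its rows, of the rest of each of its columns, and of
the complementary submatrix. -/
def auxMatrix {m n : ℕ} (k : ℕ) (X : Fin m × Fin n → ℝ) : Fin k × Fin k → ℝ :=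
  fun q => sInf (X '' (mergedInto m n q : Set (Fin m × Fin n)))

/-- The rate matrix of the auxiliary matrix: the same with sums in place of minima. -/
def auxRate {m n : ℕ} (k : ℕ) (A : Fin m × Fin n → ℝ) : Fin k × Fin k → ℝ :=
  fun q => ∑ p ∈ mergedInto m n q, A p

/-! The two facts below show that the minimum is attained and that the expected contribution
is the expectation of an integrable random variable. -/

theorem exists_isAssignment {k m n : ℕ} (hm : k ≤ m) (hn : k ≤ n) :
    ∃ σ : Finset (Fin m × Fin n), IsAssignment k σ := by
  refine ⟨Finset.univ.map ⟨fun a : Fin k => (Fin.castLE hm a, Fin.castLE hn a), ?_⟩, ?_, ?_, ?_⟩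
  · intro a b h
    simpa using h
  · simp
  · intro p hp q hq h
    simp only [Finset.coe_map, Finset.coe_univ, Set.image_univ,
      Set.mem_range] at hp hq
    obtain ⟨a, rfl⟩ := hp
    obtain ⟨b, rfl⟩ := hq
    have : a = b := by
      have h' := congrArg Fin.val h
      exact Fin.ext h'
    rw [this]
  · intro p hp q hq h
    simp only [Finset.coe_map, Finset.coe_univ, Set.image_univ,
      Set.mem_range] at hp hq
    obtain ⟨a, rfl⟩ := hp
    obtain ⟨b, rfl⟩ := hq
    have : a = b := by
      have h' := congrArg Fin.val h
      exact Fin.ext h'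
    rw [this]

theorem isLeast_minValue {k m n : ℕ} (hm : k ≤ m) (hn : k ≤ n) (X : Fin m × Fin n → ℝ) :
    IsLeast ((fun σ : Finset (Fin m × Fin n) => ∑ p ∈ σ, X p) '' {σ | IsAssignment k σ})
      (minValue k X) := by
  have hfin := Set.toFinite
    ((fun σ : Finset (Fin m × Fin n) => ∑ p ∈ σ, X p) '' {σ | IsAssignment k σ})
  have hne : ((fun σ : Finset (Fin m × Fin n) => ∑ p ∈ σ, X p) ''
      {σ | IsAssignment k σ}).Nonempty := by
    obtain ⟨σ, hσ⟩ := exists_isAssignment hm hn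
    exact ⟨_, σ, hσ, rfl⟩
  exact ⟨hne.csInf_mem hfin, fun x hx => csInf_le hfin.bddBelow hx⟩

theorem integrable_id_expMeasure {a : ℝ} (ha : 0 < a) :
    Integrable (fun x : ℝ => x) (expMeasure a) := by
  have hm : Measurable (exponentialPDF a) :=
    (measurable_exponentialPDFReal a).ennreal_ofReal
  have hpdf : expMeasure a = volume.withDensity (exponentialPDF a) := rfl
  rw [hpdf, integrable_withDensity_iff hm (Filter.Eventually.of_forall
    fun x => ENNReal.ofReal_lt_top)]
  have h0 : IntegrableOn (fun x : ℝ => x * (a * Real.exp (-(a * x)))) (Set.Ioi 0) := by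
    have := (integrableOn_rpow_mul_exp_neg_mul_rpow (s := 1) (p := 1) (b := a)
      (by norm_num) (by norm_num) ha).const_mul a
    refine MeasureTheory.IntegrableOn.congr_fun (f := fun x : ℝ => a * (x ^ (1 : ℝ) *
      Real.exp (-a * x ^ (1 : ℝ)))) this (fun x _ => ?_) measurableSet_Ioi
    simp only [Real.rpow_one, neg_mul]
    ring
  have h1 : IntegrableOn (fun x : ℝ => x * (a * Real.exp (-(a * x)))) (Set.Ici 0) :=
    Iff.mpr integrableOn_Ici_iff_integrableOn_Ioi h0
  refine (h1.integrable_indicator measurableSet_Ici).congr (Filter.Eventually.of_forall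
    fun x => ?_)
  change _ = x * (exponentialPDF a x).toReal
  by_cases hx : 0 ≤ x
  · rw [Set.indicator_of_mem (Set.mem_Ici.mpr hx), exponentialPDF_of_nonneg hx,
      ENNReal.toReal_ofReal (by positivity)]
  · rw [Set.indicator_of_notMem (by simpa using hx), exponentialPDF_of_neg (not_le.mp hx)]
    simp

theorem measurableSet_containsMin {k m n : ℕ} (I : Finset (Fin m)) (J : Finset (Fin n)) :
    MeasurableSet (containsMin k I J) := by
  have : containsMin k I J = ⋃ σ : Finset (Fin m × Fin n), ⋃ _ : IsAssignment (k - 1) σ,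
      ⋃ _ : σ ⊆ I ×ˢ J, ⋂ τ : Finset (Fin m × Fin n), ⋂ _ : IsAssignment (k - 1) τ,
        {X | ∑ p ∈ σ, X p ≤ ∑ p ∈ τ, X p} := by
    ext X
    simp only [containsMin, IsMinAssignment, Set.mem_ofPred_eq, Set.mem_iUnion, Set.mem_iInter,
      exists_prop]
    exact exists_congr fun σ => by tauto
  rw [this]
  refine MeasurableSet.iUnion fun σ => MeasurableSet.iUnion fun _ => MeasurableSet.iUnion
    fun _ => MeasurableSet.iInter fun τ => MeasurableSet.iInter fun _ => ?_
  exact measurableSet_le (by fun_prop) (by fun_prop)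

theorem measurable_minValue {k m n : ℕ} :
    Measurable (minValue k : (Fin m × Fin n → ℝ) → ℝ) := by
  have : (minValue k : (Fin m × Fin n → ℝ) → ℝ) = fun X =>
      ⨅ σ : {σ : Finset (Fin m × Fin n) // IsAssignment k σ}, ∑ p ∈ σ.1, X p := by
    funext X
    rw [minValue, sInf_image']
    rfl
  rw [this]
  exact Measurable.iInf fun σ => by fun_prop

theorem integrable_contribution {k m n : ℕ} (hm : k ≤ m) (hn : k ≤ n)
    {A : Fin m × Fin n → ℝ} (hA : ∀ p, 0 < A p) (I : Finset (Fin m)) (J : Finset (Fin n)) :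
    Integrable (contribution k I J) (expMatrixLaw A) := by
  have : ∀ p, IsProbabilityMeasure (expMeasure (A p)) :=
    fun p => isProbabilityMeasure_expMeasure (hA p)
  have hent : ∀ p, Integrable (fun X : Fin m × Fin n → ℝ => X p) (expMatrixLaw A) := fun p =>
    (measurePreserving_eval (fun p => expMeasure (A p)) p).integrable_comp_of_integrable
      (integrable_id_expMeasure (hA p))
  have hsum : Integrable (fun X : Fin m × Fin n → ℝ => ∑ p, |X p|) (expMatrixLaw A) :=
    integrable_finsetSum _ fun p _ => (hent p).abs
  refine hsum.mono' ?_ (Filter.Eventually.of_forall fun X => ?_)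
  · exact ((measurable_const.indicator (measurableSet_containsMin I J)).mul
      measurable_minValue).aestronglyMeasurable
  · obtain ⟨σ, -, hσ⟩ := (isLeast_minValue hm hn X).1
    have h1 : |minValue k X| ≤ ∑ p, |X p| := by
      rw [← hσ]
      exact (Finset.abs_sum_le_sum_abs _ _).trans
        (Finset.sum_le_sum_of_subset_of_nonneg (Finset.subset_univ _) fun _ _ _ => abs_nonneg _)
    refine le_trans ?_ h1
    rw [contribution, Real.norm_eq_abs, abs_mul]
    refine mul_le_of_le_one_left (abs_nonneg _) ?_
    by_cases hX : X ∈ containsMin k I J <;> simp [hX]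

end RandomAssignment

end

namespace RandomAssignment

/-! ### Exchange between assignments of different sizes. -/

section Exchange

variable {ι κ : Type*}

/-! Both parts follow from an identity that holds for each matrix, with no randomness. Collapse all
rows outside `I` to one row and all columns outside `J` to one column, replacing entries by minima
over the merged positions. The value of `contribution` does not change (`contribution_mergeMin`),
although merging destroys every assignment that uses two rows outside `I` or two columns outside
`J`.

Such assignments are irrelevant because of an exchange argument (`exists_exchange`). If `σ` is a
minimum (k-1)-assignment in `I ×ˢ J`, some minimum k-assignment meets all rows and columns of `σ`,
hence only one row and one column outside; it survives the merging. Likewise, minimality of `σ` can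
be tested against assignments meeting at most one new row and one new column
(`isMinAssignment_of_isNear`). Conversely, each assignment of the merged matrix lifts to one of
equal cost.

Since minima of independent exponentials over disjoint blocks are independent exponentials with
summed rates (`map_mergeMin_pi_expMeasure`), integrating gives (b). For (a), merging keeps the rates
of the form `r_i c_j`, and the predicted value depends only on the weights in `I` and `J` and on the
totals, all of which merging preserves. Every positive weight vector on the small side arises by
merging, so the conjecture passes in both directions. -/

theorem IsAssignment.fst_eq {k : ℕ} {σ : Finset (ι × κ)} (h : IsAssignment k σ) {p q : ι × κ}
    (hp : p ∈ σ) (hq : q ∈ σ) (hpq : p.1 = q.1) : p = q :=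
  h.2.1 hp hq hpq

theorem IsAssignment.snd_eq {k : ℕ} {σ : Finset (ι × κ)} (h : IsAssignment k σ) {p q : ι × κ}
    (hp : p ∈ σ) (hq : q ∈ σ) (hpq : p.2 = q.2) : p = q :=
  h.2.2 hp hq hpq

variable [DecidableEq ι] [DecidableEq κ]

theorem IsAssignment.insert {k : ℕ} {σ : Finset (ι × κ)} (h : IsAssignment k σ) {p : ι × κ}
    (h1 : p.1 ∉ σ.image Prod.fst) (h2 : p.2 ∉ σ.image Prod.snd) :
    IsAssignment (k + 1) (insert p σ) := by
  have hp : p ∉ σ := fun hp => h1 (Finset.mem_image_of_mem _ hp)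
  refine ⟨by rw [Finset.card_insert_of_notMem hp, h.1], ?_, ?_⟩
  · rw [Finset.coe_insert, Set.injOn_insert (by exact_mod_cast hp)]
    exact ⟨h.2.1, by exact_mod_cast h1⟩
  · rw [Finset.coe_insert, Set.injOn_insert (by exact_mod_cast hp)]
    exact ⟨h.2.2, by exact_mod_cast h2⟩

theorem IsAssignment.erase {k : ℕ} {σ : Finset (ι × κ)} (h : IsAssignment (k + 1) σ) {p : ι × κ}
    (hp : p ∈ σ) : IsAssignment k (σ.erase p) := by
  refine ⟨by rw [Finset.card_erase_of_mem hp, h.1, Nat.add_sub_cancel], ?_, ?_⟩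
  · exact h.2.1.mono (by simp)
  · exact h.2.2.mono (by simp)

omit [DecidableEq κ] in
theorem IsAssignment.card_fst {k : ℕ} {σ : Finset (ι × κ)} (h : IsAssignment k σ) :
    (σ.image Prod.fst).card = k := by
  rw [Finset.card_image_of_injOn h.2.1, h.1]

omit [DecidableEq ι] in
theorem IsAssignment.card_snd {k : ℕ} {σ : Finset (ι × κ)} (h : IsAssignment k σ) :
    (σ.image Prod.snd).card = k := by
  rw [Finset.card_image_of_injOn h.2.2, h.1]

theorem IsAssignment.fst_notMem_erase {k : ℕ} {σ : Finset (ι × κ)} (h : IsAssignment k σ)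
    {p : ι × κ} (hp : p ∈ σ) : p.1 ∉ (σ.erase p).image Prod.fst := by
  intro hm
  obtain ⟨q, hq, hqp⟩ := Finset.mem_image.1 hm
  exact (Finset.mem_erase.1 hq).1 (h.fst_eq (Finset.mem_of_mem_erase hq) hp hqp)

theorem IsAssignment.snd_notMem_erase {k : ℕ} {σ : Finset (ι × κ)} (h : IsAssignment k σ)
    {p : ι × κ} (hp : p ∈ σ) : p.2 ∉ (σ.erase p).image Prod.snd := by
  intro hm
  obtain ⟨q, hq, hqp⟩ := Finset.mem_image.1 hm
  exact (Finset.mem_erase.1 hq).1 (h.snd_eq (Finset.mem_of_mem_erase hq) hp hqp)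

/-- Two assignments of different sizes can be exchanged, with the same positions used (counted
with multiplicity), so that the smaller one grows by one position and still meets all its rows
and columns, while the larger one shrinks by one position and meets no new row or column. -/
theorem exists_exchange (a : ℕ) : ∀ (b : ℕ) (_ : a ≤ b) (σ ρ : Finset (ι × κ))
    (_ : IsAssignment a σ) (_ : IsAssignment (b + 1) ρ), ∃ α β : Finset (ι × κ),
      IsAssignment (a + 1) α ∧ IsAssignment b β ∧ α ⊆ σ ∪ ρ ∧ β ⊆ σ ∪ ρ ∧
      σ.image Prod.fst ⊆ α.image Prod.fst ∧ σ.image Prod.snd ⊆ α.image Prod.snd ∧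
      β.image Prod.fst ⊆ ρ.image Prod.fst ∧ β.image Prod.snd ⊆ ρ.image Prod.snd ∧
      ∀ f : ι × κ → ℝ, ∑ p ∈ α, f p + ∑ p ∈ β, f p = ∑ p ∈ σ, f p + ∑ p ∈ ρ, f p := by
  induction a using Nat.strong_induction_on with
  | _ a ih =>
  intro b hab σ ρ hσ hρ
  -- As `ρ` is larger, it has a position `e` in a row that `σ` misses. If the column of `e` is free
  -- in `σ` as well, moving `e` from `ρ` to `σ` is enough.
  obtain ⟨r, hrρ, hrσ⟩ := Finset.exists_mem_notMem_of_card_lt_card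
    (show (σ.image Prod.fst).card < (ρ.image Prod.fst).card by
      rw [hσ.card_fst, hρ.card_fst]; omega)
  obtain ⟨e, he, rfl⟩ := Finset.mem_image.1 hrρ
  by_cases hc : e.2 ∈ σ.image Prod.snd
  swap
  · refine ⟨insert e σ, ρ.erase e, hσ.insert hrσ hc, hρ.erase he, ?_, ?_, ?_, ?_, ?_, ?_, ?_⟩
    · exact Finset.insert_subset (Finset.mem_union_right _ he) Finset.subset_union_left
    · exact (Finset.erase_subset _ _).trans Finset.subset_union_right
    · exact Finset.image_subset_image (Finset.subset_insert _ _)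
    · exact Finset.image_subset_image (Finset.subset_insert _ _)
    · exact Finset.image_subset_image (Finset.erase_subset _ _)
    · exact Finset.image_subset_image (Finset.erase_subset _ _)
    · intro f
      have heσ : e ∉ σ := fun h => hrσ (Finset.mem_image_of_mem _ h)
      rw [Finset.sum_insert heσ, ← Finset.add_sum_erase _ _ he]
      ring
  -- Otherwise some `d` in `σ` blocks the column of `e`. Remove `d` and `e`, exchange the rest by
  -- induction, and then return one of them to each side.
  obtain ⟨d, hd, hde⟩ := Finset.mem_image.1 hc
  have hne : d ≠ e := fun h => hrσ (h ▸ Finset.mem_image_of_mem _ hd)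
  obtain ⟨a, rfl⟩ : ∃ a', a = a' + 1 :=
    Nat.exists_eq_succ_of_ne_zero (by rw [← hσ.1]; exact Finset.card_ne_zero_of_mem hd)
  obtain ⟨b, rfl⟩ : ∃ b', b = b' + 1 := Nat.exists_eq_succ_of_ne_zero (by omega)
  obtain ⟨α, β, hα, hβ, hαs, hβs, h1, h2, h3, h4, hsum⟩ :=
    ih a (Nat.lt_succ_self a) b (by omega) (σ.erase d) (ρ.erase e) (hσ.erase hd) (hρ.erase he)
  have hcol : ∀ q ∈ σ.erase d ∪ ρ.erase e, q.2 ≠ e.2 := by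
    intro q hq h
    rcases Finset.mem_union.1 hq with hq | hq
    · exact hσ.snd_notMem_erase hd (hde ▸ h ▸ Finset.mem_image_of_mem _ hq)
    · exact hρ.snd_notMem_erase he (h ▸ Finset.mem_image_of_mem _ hq)
  have hrow : ∀ q ∈ σ.erase d ∪ ρ.erase e, q.1 ≠ e.1 := by
    intro q hq h
    rcases Finset.mem_union.1 hq with hq | hq
    · exact hrσ (h ▸ Finset.mem_image_of_mem _ (Finset.mem_of_mem_erase hq))
    · exact hρ.fst_notMem_erase he (h ▸ Finset.mem_image_of_mem _ hq)
  have hcα : e.2 ∉ α.image Prod.snd := fun h => by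
    obtain ⟨q, hq, hqe⟩ := Finset.mem_image.1 h
    exact hcol q (hαs hq) hqe
  have hcβ : e.2 ∉ β.image Prod.snd := fun h => by
    obtain ⟨q, hq, hqe⟩ := Finset.mem_image.1 h
    exact hcol q (hβs hq) hqe
  have hrα : e.1 ∉ α.image Prod.fst := fun h => by
    obtain ⟨q, hq, hqe⟩ := Finset.mem_image.1 h
    exact hrow q (hαs hq) hqe
  have hrβ : e.1 ∉ β.image Prod.fst := fun h => by
    obtain ⟨q, hq, hqe⟩ := Finset.mem_image.1 h
    exact hrow q (hβs hq) hqe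
  have hsub : σ.erase d ∪ ρ.erase e ⊆ σ ∪ ρ :=
    Finset.union_subset_union (Finset.erase_subset _ _) (Finset.erase_subset _ _)
  have hσe : insert d (σ.erase d) = σ := Finset.insert_erase hd
  have hρe : insert e (ρ.erase e) = ρ := Finset.insert_erase he
  have hsum' : ∀ f : ι × κ → ℝ, ∀ x y, (x = d ∧ y = e) ∨ (x = e ∧ y = d) → x ∉ α → y ∉ β →
      ∑ p ∈ insert x α, f p + ∑ p ∈ insert y β, f p = ∑ p ∈ σ, f p + ∑ p ∈ ρ, f p := by
    intro f x y hxy hx hy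
    have := hsum f
    rw [Finset.sum_insert hx, Finset.sum_insert hy, ← Finset.add_sum_erase _ _ hd,
      ← Finset.add_sum_erase _ _ he]
    rcases hxy with ⟨rfl, rfl⟩ | ⟨rfl, rfl⟩ <;> linarith
  -- Both sides are free in the column shared by `d` and `e` and in the row of `e`. Only the row of
  -- `d` can obstruct, so it decides which side receives `d`.
  by_cases hr0 : d.1 ∈ α.image Prod.fst
  · obtain ⟨p, hp, hpd⟩ := Finset.mem_image.1 hr0
    have hmem : ∀ q ∈ σ.erase d ∪ ρ.erase e, q.1 = d.1 → q ∈ ρ.erase e := by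
      intro q hq hqd
      rcases Finset.mem_union.1 hq with hq | hq
      · exact absurd (hqd ▸ Finset.mem_image_of_mem _ hq) (hσ.fst_notMem_erase hd)
      · exact hq
    have hpρ := hmem p (hαs hp) hpd
    have hdβ : d.1 ∉ β.image Prod.fst := by
      intro h
      obtain ⟨q, hq, hqd⟩ := Finset.mem_image.1 h
      have hqp : q = p := (hρ.erase he).fst_eq (hmem q (hβs hq) hqd) hpρ (hqd.trans hpd.symm)
      subst hqp
      have hqσ : q ∉ σ.erase d := fun h =>
        hσ.fst_notMem_erase hd (hqd ▸ Finset.mem_image_of_mem _ h)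
      -- The sum identity at an indicator counts multiplicities: `q` would occur twice in `α` and
      -- `β` together, but only once in the two sets they come from.
      have := hsum (fun x => if x = q then 1 else 0)
      simp only [Finset.sum_ite_eq', hp, hq, hqσ, hpρ, if_true, if_false] at this
      norm_num at this
    refine ⟨insert e α, insert d β, hα.insert hrα hcα, hβ.insert hdβ (by rwa [hde]), ?_, ?_, ?_,
      ?_, ?_, ?_, ?_⟩
    · exact Finset.insert_subset (Finset.mem_union_right _ he) (hαs.trans hsub)
    · exact Finset.insert_subset (Finset.mem_union_left _ hd) (hβs.trans hsub)
    · rw [← hσe, Finset.image_insert, Finset.image_insert]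
      exact Finset.insert_subset (Finset.mem_insert_of_mem hr0)
        (h1.trans (Finset.subset_insert _ _))
    · rw [← hσe, Finset.image_insert, Finset.image_insert, hde]
      exact Finset.insert_subset_insert _ h2
    · rw [Finset.image_insert, ← hpd]
      exact Finset.insert_subset (Finset.mem_image_of_mem _ (Finset.mem_of_mem_erase hpρ))
        (h3.trans (Finset.image_subset_image (Finset.erase_subset _ _)))
    · rw [Finset.image_insert, hde]
      exact Finset.insert_subset (Finset.mem_image_of_mem _ he)
        (h4.trans (Finset.image_subset_image (Finset.erase_subset _ _)))
    · intro f
      exact hsum' f e d (Or.inr ⟨rfl, rfl⟩) (fun h => hrα (Finset.mem_image_of_mem _ h))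
        (fun h => hdβ (Finset.mem_image_of_mem _ h))
  · refine ⟨insert d α, insert e β, hα.insert hr0 (by rwa [hde]), hβ.insert hrβ hcβ, ?_, ?_, ?_,
      ?_, ?_, ?_, ?_⟩
    · exact Finset.insert_subset (Finset.mem_union_left _ hd) (hαs.trans hsub)
    · exact Finset.insert_subset (Finset.mem_union_right _ he) (hβs.trans hsub)
    · rw [← hσe, Finset.image_insert, Finset.image_insert]
      exact Finset.insert_subset_insert _ h1
    · rw [← hσe, Finset.image_insert, Finset.image_insert]
      exact Finset.insert_subset_insert _ h2
    · rw [← hρe, Finset.image_insert, Finset.image_insert]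
      exact Finset.insert_subset_insert _ h3
    · rw [← hρe, Finset.image_insert, Finset.image_insert]
      exact Finset.insert_subset_insert _ h4
    · intro f
      exact hsum' f d e (Or.inl ⟨rfl, rfl⟩) (fun h => hr0 (Finset.mem_image_of_mem _ h))
        (fun h => hrβ (Finset.mem_image_of_mem _ h))

/-- `τ` meets at most one row and at most one column that `σ` does not meet. -/
def IsNear (σ τ : Finset (ι × κ)) : Prop :=
  (τ.image Prod.fst \ σ.image Prod.fst).card ≤ 1 ∧ (τ.image Prod.snd \ σ.image Prod.snd).card ≤ 1

/-- Once all rows and columns of `σ` are used, a set with one more position has exactly one row and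
one column left over. -/
theorem isNear_of_image_subset {k : ℕ} {σ τ : Finset (ι × κ)} (hσ : IsAssignment k σ)
    (hτ : IsAssignment (k + 1) τ) (h1 : σ.image Prod.fst ⊆ τ.image Prod.fst)
    (h2 : σ.image Prod.snd ⊆ τ.image Prod.snd) : IsNear σ τ := by
  refine ⟨?_, ?_⟩
  · rw [Finset.card_sdiff_of_subset h1, hσ.card_fst, hτ.card_fst]; omega
  · rw [Finset.card_sdiff_of_subset h2, hσ.card_snd, hτ.card_snd]; omega

theorem IsNear.mono {σ σ' τ : Finset (ι × κ)} (h : IsNear σ τ)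
    (h1 : σ.image Prod.fst ⊆ σ'.image Prod.fst) (h2 : σ.image Prod.snd ⊆ σ'.image Prod.snd) :
    IsNear σ' τ :=
  ⟨(Finset.card_le_card (Finset.sdiff_subset_sdiff le_rfl h1)).trans h.1,
    (Finset.card_le_card (Finset.sdiff_subset_sdiff le_rfl h2)).trans h.2⟩

/-- From a minimum assignment `σ`, any larger assignment can be replaced by one that is no more
expensive and meets all rows and columns of `σ`. -/
theorem IsMinAssignment.exists_le {k : ℕ} {X : ι × κ → ℝ} {σ ρ : Finset (ι × κ)}
    (hσ : IsMinAssignment k X σ) (hρ : IsAssignment (k + 1) ρ) :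
    ∃ α, IsAssignment (k + 1) α ∧ IsNear σ α ∧ ∑ p ∈ α, X p ≤ ∑ p ∈ ρ, X p := by
  obtain ⟨α, β, hα, hβ, -, -, h1, h2, -, -, hsum⟩ := exists_exchange k k le_rfl σ ρ hσ.1 hρ
  refine ⟨α, hα, isNear_of_image_subset hσ.1 hα h1 h2, ?_⟩
  have := hσ.2 β hβ
  have := hsum X
  linarith

/-- An assignment that is minimum among the near ones is minimum. -/
theorem isMinAssignment_of_isNear {X : ι × κ → ℝ} {k : ℕ} : ∀ {σ : Finset (ι × κ)},
    IsAssignment k σ →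
    (∀ τ, IsAssignment k τ → IsNear σ τ → ∑ p ∈ σ, X p ≤ ∑ p ∈ τ, X p) →
    IsMinAssignment k X σ := by
  induction k with
  | zero =>
    intro σ hσ _
    refine ⟨hσ, fun τ hτ => ?_⟩
    rw [Finset.card_eq_zero.1 hσ.1, Finset.card_eq_zero.1 hτ.1]
  | succ k ih =>
    intro σ hσ hloc
    obtain ⟨e, he⟩ : σ.Nonempty := Finset.card_pos.1 (by rw [hσ.1]; omega)
    set S : Set (Finset (ι × κ)) := {β | IsAssignment k β ∧
      β.image Prod.fst ⊆ σ.image Prod.fst ∧ β.image Prod.snd ⊆ σ.image Prod.snd} with hS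
    have hfin : S.Finite := by
      refine (Finset.finite_toSet (σ.image Prod.fst ×ˢ σ.image Prod.snd).powerset).subset ?_
      intro β hβ
      simp only [Finset.mem_coe, Finset.mem_powerset]
      exact fun p hp => Finset.mem_product.2
        ⟨hβ.2.1 (Finset.mem_image_of_mem _ hp), hβ.2.2 (Finset.mem_image_of_mem _ hp)⟩
    have hne : S.Nonempty := ⟨σ.erase e, hσ.erase he,
      Finset.image_subset_image (Finset.erase_subset _ _),
      Finset.image_subset_image (Finset.erase_subset _ _)⟩
    -- The cheapest assignment of size `k` within the rows and columns of `σ`. It inherits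
    -- minimality among its near assignments from `σ`, so the induction hypothesis makes it a global
    -- minimum.
    obtain ⟨β, ⟨hβ, hβ1, hβ2⟩, hmin⟩ :=
      Set.exists_min_image S (fun β => ∑ p ∈ β, X p) hfin hne
    have hβmin : IsMinAssignment k X β := by
      refine ih hβ fun μ hμ hnear => ?_
      -- Exchanging `μ` with `σ` gives `α`, near `σ` and so no cheaper than `σ`, and `β'`, a
      -- competitor of `β`. The total cost is unchanged, so `β` costs at most `μ`.
      obtain ⟨α, β', hα, hβ', hαs, -, -, -, h3, h4, hsum⟩ :=
        exists_exchange k k le_rfl μ σ hμ hσ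
      have hnα : IsNear σ α := by
        have hn := hnear.mono hβ1 hβ2
        refine ⟨(Finset.card_le_card ?_).trans hn.1, (Finset.card_le_card ?_).trans hn.2⟩
        · refine (Finset.sdiff_subset_sdiff (Finset.image_subset_image hαs) le_rfl).trans ?_
          rw [Finset.image_union, Finset.union_sdiff_right]
        · refine (Finset.sdiff_subset_sdiff (Finset.image_subset_image hαs) le_rfl).trans ?_
          rw [Finset.image_union, Finset.union_sdiff_right]
      have e1 := hloc α hα hnα
      have e2 := hmin β' ⟨hβ', h3, h4⟩
      have e3 := hsum X
      linarith
    refine ⟨hσ, fun ρ hρ => ?_⟩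
    obtain ⟨α, hα, hnear, hle⟩ := hβmin.exists_le hρ
    exact (hloc α hα (hnear.mono hβ1 hβ2)).trans hle

end Exchange


/-! ### Minima of independent exponential variables over blocks. -/

section MergeMin

variable {P Q : Type*} [Fintype P]

/-- The minima of the entries of `X` over the fibres of `F`. -/
noncomputable def mergeMin (F : P → Q) (X : P → ℝ) : Q → ℝ := fun q => sInf (X '' {p | F p = q})

/-- The sums of the entries of `A` over the fibres of `F`. -/
noncomputable def mergeSum [DecidableEq Q] (F : P → Q) (A : P → ℝ) : Q → ℝ :=
  fun q => ∑ p with F p = q, A p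

theorem mergeMin_le (F : P → Q) (X : P → ℝ) (p : P) : mergeMin F X (F p) ≤ X p :=
  csInf_le (Set.toFinite _).bddBelow ⟨p, rfl, rfl⟩

theorem exists_eq_mergeMin {F : P → Q} (hF : F.Surjective) (X : P → ℝ) (q : Q) :
    ∃ p, F p = q ∧ X p = mergeMin F X q := by
  obtain ⟨p₀, hp₀⟩ := hF q
  have hne : (X '' {p | F p = q}).Nonempty := ⟨X p₀, p₀, hp₀, rfl⟩
  obtain ⟨p, hp, hpX⟩ := hne.csInf_mem (Set.toFinite _)
  exact ⟨p, hp, hpX⟩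

theorem lt_mergeMin_iff {F : P → Q} (hF : F.Surjective) (X : P → ℝ) (q : Q) (t : ℝ) :
    t < mergeMin F X q ↔ ∀ p, F p = q → t < X p := by
  refine ⟨fun h p hp => h.trans_le (hp ▸ mergeMin_le F X p), fun h => ?_⟩
  obtain ⟨p, hp, hpX⟩ := exists_eq_mergeMin hF X q
  exact hpX ▸ h p hp

theorem measurable_mergeMin (F : P → Q) : Measurable (mergeMin F) := by
  refine measurable_pi_lambda _ fun q => ?_
  have : (fun X : P → ℝ => mergeMin F X q) = fun X => ⨅ p : {p | F p = q}, X p := by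
    funext X
    rw [mergeMin, sInf_image']
  rw [this]
  exact Measurable.iInf fun p => measurable_pi_apply _

theorem mergeSum_pos [DecidableEq Q] {F : P → Q} (hF : F.Surjective) {A : P → ℝ}
    (hA : ∀ p, 0 < A p) (q : Q) : 0 < mergeSum F A q := by
  obtain ⟨p, hp⟩ := hF q
  exact Finset.sum_pos (fun p _ => hA p) ⟨p, by simp [hp]⟩

/-- Survival functions turn minima into products; `max t 0` covers negative thresholds, where the
probability is 1. -/
theorem expMeasure_Ioi {a : ℝ} (ha : 0 < a) (t : ℝ) :
    expMeasure a (Set.Ioi t) = ENNReal.ofReal (Real.exp (-(a * max t 0))) := by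
  have := isProbabilityMeasure_expMeasure ha
  rw [← Set.compl_Iic, prob_compl_eq_one_sub measurableSet_Iic, ← ofReal_cdf,
    cdf_expMeasure_eq ha, ← ENNReal.ofReal_one, ← ENNReal.ofReal_sub]
  · congr 1
    split_ifs with h
    · rw [max_eq_left h]; ring
    · rw [max_eq_right (not_le.1 h).le]; simp
  · split_ifs with h
    · rw [sub_nonneg, Real.exp_le_one_iff]
      simpa using mul_nonneg ha.le h
    · exact le_rfl

/-- The minima over disjoint blocks of independent exponential variables are independent
exponential variables, whose rates are the sums of the rates over the blocks. -/
theorem map_mergeMin_pi_expMeasure [Fintype Q] [DecidableEq Q] {F : P → Q} (hF : F.Surjective)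
    {A : P → ℝ} (hA : ∀ p, 0 < A p) :
    (Measure.pi fun p => expMeasure (A p)).map (mergeMin F) =
      Measure.pi fun q => expMeasure (mergeSum F A q) := by
  have hB := mergeSum_pos hF hA
  have : ∀ p, IsProbabilityMeasure (expMeasure (A p)) :=
    fun p => isProbabilityMeasure_expMeasure (hA p)
  have : ∀ q, IsProbabilityMeasure (expMeasure (mergeSum F A q)) :=
    fun q => isProbabilityMeasure_expMeasure (hB q)
  symm
  -- It suffices to compare the two measures on products of half-lines `Ioi`. A block minimum
  -- exceeds `t` exactly when every entry of the block does, so preimages are again such products.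
  refine Measure.pi_eq_generateFrom (C := fun _ => Set.range Set.Ioi)
    (fun _ => ?_) (fun _ => isPiSystem_Ioi) (fun q => ?_) fun s hs => ?_
  · exact (borel_eq_generateFrom_Ioi ℝ).symm.trans (BorelSpace.measurable_eq).symm
  · exact
      { set := fun n => Set.Ioi (-(n : ℝ))
        set_mem := fun n => ⟨_, rfl⟩
        finite := fun n => measure_lt_top _ _
        spanning := by
          refine Set.eq_univ_of_forall fun x => Set.mem_iUnion.2 ?_
          obtain ⟨n, hn⟩ := exists_nat_gt (-x)
          exact ⟨n, by simp only [Set.mem_Ioi]; linarith⟩ }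
  · choose t ht using hs
    obtain rfl : s = fun q => Set.Ioi (t q) := funext fun q => (ht q).symm
    rw [Measure.map_apply (measurable_mergeMin F)
      (MeasurableSet.univ_pi fun q => measurableSet_Ioi)]
    have hpre : mergeMin F ⁻¹' (Set.univ.pi fun q => Set.Ioi (t q)) =
        Set.univ.pi fun p => Set.Ioi (t (F p)) := by
      ext X
      simp only [Set.mem_preimage, Set.mem_univ_pi, Set.mem_Ioi, lt_mergeMin_iff hF]
      exact ⟨fun h p => h _ p rfl, fun h q p hp => hp ▸ h p⟩
    rw [hpre, Measure.pi_pi, ← Finset.prod_fiberwise_of_maps_to (g := F) (t := Finset.univ)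
      (fun p _ => Finset.mem_univ _)]
    refine Finset.prod_congr rfl fun q _ => ?_
    rw [expMeasure_Ioi (hB q)]
    simp_rw [expMeasure_Ioi (hA _)]
    rw [← ENNReal.ofReal_prod_of_nonneg (fun _ _ => (Real.exp_pos _).le), ← Real.exp_sum,
      mergeSum, Finset.sum_mul, Finset.sum_neg_distrib]
    congr 3
    refine Finset.sum_congr rfl fun p hp => ?_
    rw [(Finset.mem_filter.1 hp).2]

end MergeMin

/-! ### Merging rows and columns, and its effect on assignments. -/

section Merge

variable {ι κ ι' κ' : Type*}

/-- A merge map for the index set `I`: it is onto, is injective on `I`, and maps exactly the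
indices outside `I` to `a`. -/
structure IsMerge (I : Finset ι) (a : ι') (f : ι → ι') : Prop where
  surjective : f.Surjective
  injOn : Set.InjOn f I
  eq_iff : ∀ i, f i = a ↔ i ∉ I

/-- Only indices outside `I` are identified with one another. This is where nearness is used: a near
assignment has no two rows or columns that collide. -/
theorem IsMerge.injOn_of_card_sdiff_le_one [DecidableEq ι] {I : Finset ι} {a : ι'} {f : ι → ι'}
    (h : IsMerge I a f) {S : Finset ι} (hS : (S \ I).card ≤ 1) : Set.InjOn f S := by
  intro i hi j hj hij
  by_cases hiI : i ∈ I
  · have hjI : j ∈ I := by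
      by_contra hjI
      exact (h.eq_iff i).1 (hij.trans ((h.eq_iff j).2 hjI)) hiI
    exact h.injOn hiI hjI hij
  · have hjI : j ∉ I := fun hjI => (h.eq_iff j).1 (hij.symm.trans ((h.eq_iff i).2 hiI)) hjI
    exact Finset.card_le_one.1 hS i (Finset.mem_sdiff.2 ⟨hi, hiI⟩) j (Finset.mem_sdiff.2 ⟨hj, hjI⟩)

theorem IsMerge.mem_image_iff [DecidableEq ι'] {I : Finset ι} {a : ι'} {f : ι → ι'}
    (h : IsMerge I a f) (i : ι) : f i ∈ I.image f ↔ i ∈ I := by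
  refine ⟨fun hi => ?_, Finset.mem_image_of_mem f⟩
  obtain ⟨j, hj, hji⟩ := Finset.mem_image.1 hi
  by_contra hiI
  exact (h.eq_iff j).1 (hji.trans ((h.eq_iff i).2 hiI)) hj

/-- An index that is not merged has itself alone in its fibre. -/
theorem IsMerge.eq_of_mem {I : Finset ι} {a : ι'} {f : ι → ι'} (h : IsMerge I a f) {i j : ι}
    (hi : i ∈ I) (hij : f j = f i) : j = i := by
  refine h.injOn ?_ hi hij
  by_contra hj
  exact (h.eq_iff i).1 (hij.symm.trans ((h.eq_iff j).2 hj)) hi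

variable [Fintype ι] [Fintype κ]

/-- Every assignment of the merged matrix comes from one of the original matrix. -/
theorem exists_lift [DecidableEq ι] [DecidableEq κ] {f : ι → ι'} {g : κ → κ'}
    (hf : f.Surjective) (hg : g.Surjective) (X : ι × κ → ℝ) {l : ℕ} {τ : Finset (ι' × κ')}
    (hτ : IsAssignment l τ) : ∃ ρ : Finset (ι × κ), IsAssignment l ρ ∧
      (∀ p ∈ ρ, Prod.map f g p ∈ τ) ∧
      ∑ p ∈ ρ, X p = ∑ q ∈ τ, mergeMin (Prod.map f g) X q := by
  -- Lift each merged position to one attaining its minimum. Distinct merged rows and columns have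
  -- disjoint fibres, so no conflict arises.
  choose s hs hsX using exists_eq_mergeMin (hf.prodMap hg) X
  have hinj : Set.InjOn s τ := fun p _ q _ hpq => by rw [← hs p, ← hs q, hpq]
  have hfst : ∀ q, f (s q).1 = q.1 := fun q => congrArg Prod.fst (hs q)
  have hsnd : ∀ q, g (s q).2 = q.2 := fun q => congrArg Prod.snd (hs q)
  refine ⟨τ.image s, ⟨by rw [Finset.card_image_of_injOn hinj, hτ.1], ?_, ?_⟩, ?_, ?_⟩
  · rw [Finset.coe_image]
    rintro _ ⟨p, hp, rfl⟩ _ ⟨q, hq, rfl⟩ hpq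
    rw [hτ.fst_eq hp hq (by rw [← hfst p, ← hfst q, hpq])]
  · rw [Finset.coe_image]
    rintro _ ⟨p, hp, rfl⟩ _ ⟨q, hq, rfl⟩ hpq
    rw [hτ.snd_eq hp hq (by rw [← hsnd p, ← hsnd q, hpq])]
  · intro p hp
    obtain ⟨q, hq, rfl⟩ := Finset.mem_image.1 hp
    rwa [hs]
  · rw [Finset.sum_image hinj]
    exact Finset.sum_congr rfl fun q _ => hsX q

variable [DecidableEq ι'] [DecidableEq κ']

/-- An assignment whose rows and columns are not merged gives one of the merged matrix. -/
theorem IsAssignment.image [DecidableEq ι] [DecidableEq κ] {f : ι → ι'} {g : κ → κ'} {l : ℕ}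
    {σ : Finset (ι × κ)} (hσ : IsAssignment l σ) (hf : Set.InjOn f (σ.image Prod.fst))
    (hg : Set.InjOn g (σ.image Prod.snd)) (X : ι × κ → ℝ) :
    IsAssignment l (σ.image (Prod.map f g)) ∧
      ∑ q ∈ σ.image (Prod.map f g), mergeMin (Prod.map f g) X q ≤ ∑ p ∈ σ, X p := by
  have h1 : ∀ p ∈ σ, ∀ q ∈ σ, f p.1 = f q.1 → p = q := fun p hp q hq hpq =>
    hσ.fst_eq hp hq (hf (Finset.mem_image_of_mem _ hp) (Finset.mem_image_of_mem _ hq) hpq)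
  have h2 : ∀ p ∈ σ, ∀ q ∈ σ, g p.2 = g q.2 → p = q := fun p hp q hq hpq =>
    hσ.snd_eq hp hq (hg (Finset.mem_image_of_mem _ hp) (Finset.mem_image_of_mem _ hq) hpq)
  have hinj : Set.InjOn (Prod.map f g) σ := fun p hp q hq hpq =>
    h1 p hp q hq (congrArg Prod.fst hpq)
  refine ⟨⟨by rw [Finset.card_image_of_injOn hinj, hσ.1], ?_, ?_⟩, ?_⟩
  · rw [Finset.coe_image]
    rintro _ ⟨p, hp, rfl⟩ _ ⟨q, hq, rfl⟩ hpq
    rw [h1 p hp q hq hpq]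
  · rw [Finset.coe_image]
    rintro _ ⟨p, hp, rfl⟩ _ ⟨q, hq, rfl⟩ hpq
    rw [h2 p hp q hq hpq]
  · rw [Finset.sum_image hinj]
    exact Finset.sum_le_sum fun p _ => mergeMin_le _ X p

end Merge

/-! ### Invariance of the contribution under merging. -/

section Contribution

variable {k m n : ℕ} {I : Finset (Fin m)} {J : Finset (Fin n)} {a b : Fin k}
  {f : Fin m → Fin k} {g : Fin n → Fin k}

/-- By counting, such an assignment fills every row and column of the block, so being near it means
having at most one row outside `I` and one column outside `J`. -/
theorem IsAssignment.image_eq_of_subset {l : ℕ} {σ : Finset (Fin m × Fin n)}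
    (hσ : IsAssignment l σ) (hs : σ ⊆ I ×ˢ J) (hI : I.card = l) (hJ : J.card = l) :
    σ.image Prod.fst = I ∧ σ.image Prod.snd = J := by
  refine ⟨Finset.eq_of_subset_of_card_le (fun i hi => ?_) (by rw [hσ.card_fst, hI]),
    Finset.eq_of_subset_of_card_le (fun j hj => ?_) (by rw [hσ.card_snd, hJ])⟩
  · obtain ⟨p, hp, rfl⟩ := Finset.mem_image.1 hi
    exact (Finset.mem_product.1 (hs hp)).1
  · obtain ⟨p, hp, rfl⟩ := Finset.mem_image.1 hj
    exact (Finset.mem_product.1 (hs hp)).2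

theorem IsAssignment.image_of_isNear {l : ℕ} (hf : IsMerge I a f) (hg : IsMerge J b g)
    {σ τ : Finset (Fin m × Fin n)} (hI : σ.image Prod.fst = I) (hJ : σ.image Prod.snd = J)
    (hτ : IsAssignment l τ) (hnear : IsNear σ τ) (X : Fin m × Fin n → ℝ) :
    IsAssignment l (τ.image (Prod.map f g)) ∧
      ∑ q ∈ τ.image (Prod.map f g), mergeMin (Prod.map f g) X q ≤ ∑ p ∈ τ, X p :=
  hτ.image (hf.injOn_of_card_sdiff_le_one (hI ▸ hnear.1))
    (hg.injOn_of_card_sdiff_le_one (hJ ▸ hnear.2)) X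

/-- Positions in `I ×ˢ J` are not merged with others. Lifting handles all competitors in the merged
matrix; in the original matrix only near competitors need checking, and these have images that are
assignments of no greater cost. -/
theorem mem_containsMin_mergeMin_iff (hf : IsMerge I a f) (hg : IsMerge J b g)
    (hI : I.card = k - 1) (hJ : J.card = k - 1) (X : Fin m × Fin n → ℝ) :
    mergeMin (Prod.map f g) X ∈ containsMin k (I.image f) (J.image g) ↔
      X ∈ containsMin k I J := by
  constructor
  · rintro ⟨σ', ⟨hσ', hmin⟩, hs'⟩
    obtain ⟨σ, hσ, hm, hsum⟩ := exists_lift hf.surjective hg.surjective X hσ'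
    have hs : σ ⊆ I ×ˢ J := fun p hp => by
      have := Finset.mem_product.1 (hs' (hm p hp))
      exact Finset.mem_product.2 ⟨(hf.mem_image_iff _).1 this.1, (hg.mem_image_iff _).1 this.2⟩
    obtain ⟨h1, h2⟩ := hσ.image_eq_of_subset hs hI hJ
    refine ⟨σ, isMinAssignment_of_isNear hσ fun τ hτ hnear => ?_, hs⟩
    obtain ⟨hτ', hle⟩ := hτ.image_of_isNear hf hg h1 h2 hnear X
    exact (hsum.trans_le (hmin _ hτ')).trans hle
  · rintro ⟨σ, ⟨hσ, hmin⟩, hs⟩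
    obtain ⟨h1, h2⟩ := hσ.image_eq_of_subset hs hI hJ
    obtain ⟨hσ', hle⟩ := hσ.image (h1 ▸ hf.injOn) (h2 ▸ hg.injOn) X
    refine ⟨_, ⟨hσ', fun τ hτ => ?_⟩, fun q hq => ?_⟩
    · obtain ⟨ρ, hρ, -, hsum⟩ := exists_lift hf.surjective hg.surjective X hτ
      exact hle.trans ((hmin ρ hρ).trans_eq hsum)
    · obtain ⟨p, hp, rfl⟩ := Finset.mem_image.1 hq
      have := Finset.mem_product.1 (hs hp)
      exact Finset.mem_product.2
        ⟨Finset.mem_image_of_mem _ this.1, Finset.mem_image_of_mem _ this.2⟩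

/-- Lifting never increases the optimum on passing back to `X`. The converse needs the block to
contain a minimum (k-1)-assignment: then an optimal k-assignment can be exchanged for a near one,
which survives merging. -/
theorem minValue_mergeMin (hk : 1 ≤ k) (hkm : k ≤ m) (hkn : k ≤ n) (hf : IsMerge I a f)
    (hg : IsMerge J b g) (hI : I.card = k - 1) (hJ : J.card = k - 1) {X : Fin m × Fin n → ℝ}
    (hX : X ∈ containsMin k I J) : minValue k (mergeMin (Prod.map f g) X) = minValue k X := by
  obtain ⟨σ, hσ, hs⟩ := hX
  obtain ⟨h1, h2⟩ := hσ.1.image_eq_of_subset hs hI hJ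
  obtain ⟨k, rfl⟩ : ∃ k', k = k' + 1 := ⟨k - 1, by omega⟩
  have hY := isLeast_minValue le_rfl le_rfl (mergeMin (Prod.map f g) X)
  have hX := isLeast_minValue hkm hkn X
  apply le_antisymm
  · obtain ⟨ρ, hρ, hρX⟩ := hX.1
    obtain ⟨α, hα, hnear, hle⟩ := hσ.exists_le hρ
    obtain ⟨hα', hle'⟩ := hα.image_of_isNear hf hg h1 h2 hnear X
    exact (hY.2 ⟨_, hα', rfl⟩).trans (hle'.trans (hle.trans_eq hρX))
  · obtain ⟨τ, hτ, hτY⟩ := hY.1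
    obtain ⟨ρ, hρ, -, hsum⟩ := exists_lift hf.surjective hg.surjective X hτ
    exact (hX.2 ⟨ρ, hρ, rfl⟩).trans_eq (hsum.trans hτY)

theorem contribution_mergeMin (hk : 1 ≤ k) (hkm : k ≤ m) (hkn : k ≤ n) (hf : IsMerge I a f)
    (hg : IsMerge J b g) (hI : I.card = k - 1) (hJ : J.card = k - 1) (X : Fin m × Fin n → ℝ) :
    contribution k (I.image f) (J.image g) (mergeMin (Prod.map f g) X) =
      contribution k I J X := by
  have hiff := mem_containsMin_mergeMin_iff hf hg hI hJ X
  by_cases hX : X ∈ containsMin k I J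
  · rw [contribution, contribution, Set.indicator_of_mem hX, Set.indicator_of_mem (hiff.2 hX),
      minValue_mergeMin hk hkm hkn hf hg hI hJ hX]
  · rw [contribution, contribution, Set.indicator_of_notMem hX,
      Set.indicator_of_notMem (fun h => hX (hiff.1 h)), zero_mul, zero_mul]

theorem expectedContribution_mergeSum (hk : 1 ≤ k) (hkm : k ≤ m) (hkn : k ≤ n)
    (hf : IsMerge I a f) (hg : IsMerge J b g) (hI : I.card = k - 1) (hJ : J.card = k - 1)
    {A : Fin m × Fin n → ℝ} (hA : ∀ p, 0 < A p) :
    expectedContribution k (mergeSum (Prod.map f g) A) (I.image f) (J.image g) =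
      expectedContribution k A I J := by
  rw [expectedContribution, expMatrixLaw,
    ← map_mergeMin_pi_expMeasure (hf.surjective.prodMap hg.surjective) hA,
    integral_map (measurable_mergeMin _).aemeasurable]
  · simp_rw [contribution_mergeMin hk hkm hkn hf hg hI hJ]
    rfl
  · exact ((measurable_const.indicator (measurableSet_containsMin _ _)).mul
      measurable_minValue).aestronglyMeasurable

end Contribution

/-! ### The predicted value under merging, and the equivalence in (a). -/

section Conjecture

/-- Merging a rate matrix of rank one gives a rate matrix of rank one. -/
theorem mergeSum_mul {ι κ ι' κ' : Type*} [Fintype ι] [Fintype κ] [DecidableEq ι']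
    [DecidableEq κ'] (f : ι → ι') (g : κ → κ') (r : ι → ℝ) (c : κ → ℝ) :
    mergeSum (Prod.map f g) (fun p => r p.1 * c p.2) =
      fun q => mergeSum f r q.1 * mergeSum g c q.2 := by
  funext q
  rw [mergeSum, mergeSum, mergeSum, Finset.sum_mul_sum, ← Finset.sum_product']
  refine Finset.sum_congr ?_ fun _ _ => rfl
  ext p
  simp [Prod.ext_iff]

theorem IsMerge.mergeSum_apply {ι ι' : Type*} [Fintype ι] [DecidableEq ι'] {I : Finset ι}
    {a : ι'} {f : ι → ι'} (h : IsMerge I a f) (w : ι → ℝ) {i : ι} (hi : i ∈ I) :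
    mergeSum f w (f i) = w i := by
  have : Finset.univ.filter (fun j => f j = f i) = {i} := by
    ext j
    simp only [Finset.mem_filter, Finset.mem_univ, true_and, Finset.mem_singleton]
    exact ⟨h.eq_of_mem hi, fun hj => hj ▸ rfl⟩
  rw [mergeSum, this, Finset.sum_singleton]

/-- A merge map for `I` gives a bijection from `I` onto its image. -/
noncomputable def IsMerge.equiv {ι ι' : Type*} [DecidableEq ι'] {I : Finset ι} {a : ι'} {f : ι → ι'}
    (h : IsMerge I a f) : I ≃ I.image f :=
  Equiv.ofBijective (fun i => ⟨f i, Finset.mem_image_of_mem f i.2⟩)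
    ⟨fun i j hij => Subtype.ext (h.injOn i.2 j.2 (congrArg Subtype.val hij)), fun q => by
      obtain ⟨i, hi, hiq⟩ := Finset.mem_image.1 q.2
      exact ⟨⟨i, hi⟩, Subtype.ext hiq⟩⟩

theorem IsMerge.remainingWeight_eq {ι ι' : Type*} [Fintype ι] [Fintype ι'] [DecidableEq ι']
    {I : Finset ι} {a : ι'} {f : ι → ι'} (h : IsMerge I a f) (w : ι → ℝ) {l : ℕ}
    (i : Fin l → I) (t : ℕ) :
    remainingWeight (mergeSum f w) (fun s => (h.equiv (i s) : ι')) t =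
      remainingWeight w (fun s => (i s : ι)) t := by
  rw [remainingWeight, remainingWeight]
  congr 1
  · exact Finset.sum_fiberwise_of_maps_to (fun _ _ => Finset.mem_univ _) _
  · exact Finset.sum_congr rfl fun s _ => h.mergeSum_apply w (i s).2

/-- Orderings of `I` and `J` correspond to orderings of their images. The terms involve only the
weights along these orderings and the total weights, which merging keeps. -/
theorem predictedContribution_mergeSum {ι κ ι' κ' : Type*} [Fintype ι] [Fintype κ] [Fintype ι']
    [Fintype κ'] [DecidableEq ι] [DecidableEq κ] [DecidableEq ι'] [DecidableEq κ'] (k : ℕ)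
    {I : Finset ι} {J : Finset κ} {a : ι'} {b : κ'} {f : ι → ι'} {g : κ → κ'}
    (hf : IsMerge I a f) (hg : IsMerge J b g) (r : ι → ℝ) (c : κ → ℝ) :
    predictedContribution k (mergeSum f r) (mergeSum g c) (I.image f) (J.image g) =
      predictedContribution k r c I J := by
  rw [predictedContribution, predictedContribution]
  symm
  refine Fintype.sum_equiv (Equiv.equivCongr (Equiv.refl _) hf.equiv) _ _ fun i => ?_
  refine Fintype.sum_equiv (Equiv.equivCongr (Equiv.refl _) hg.equiv) _ _ fun j => ?_
  have hr := hf.remainingWeight_eq r i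
  have hc := hg.remainingWeight_eq c j
  have hr' : ∀ t, mergeSum f r (hf.equiv (i t)) = r (i t) :=
    fun t => hf.mergeSum_apply r (i t).2
  have hc' : ∀ t, mergeSum g c (hg.equiv (j t)) = c (j t) :=
    fun t => hg.mergeSum_apply c (j t).2
  simp only [Equiv.equivCongr_apply_apply, Equiv.refl_symm, Equiv.refl_apply, hr, hc, hr', hc']

theorem exists_isMerge {k m : ℕ} (hkm : k ≤ m) {I : Finset (Fin m)} (hI : I.card = k - 1)
    (a : Fin k) (hk : 1 ≤ k) : ∃ f, IsMerge I a f := by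
  -- Both sides have `k - 1` elements, so `I` can fill all places but `a`, which takes everything
  -- outside `I`.
  have e : I ≃ {x : Fin k // x ≠ a} := Fintype.equivOfCardEq (by
    rw [Fintype.card_coe, hI, Fintype.card_subtype_compl, Fintype.card_fin,
      Fintype.card_subtype_eq])
  refine ⟨fun i => if h : i ∈ I then e ⟨i, h⟩ else a, ?_, ?_, ?_⟩
  · intro q
    by_cases hq : q = a
    · obtain ⟨i, -, hi⟩ := Finset.exists_mem_notMem_of_card_lt_card
        (show I.card < (Finset.univ : Finset (Fin m)).card by
          rw [hI, Finset.card_univ, Fintype.card_fin]; omega)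
      exact ⟨i, by simp [hi, hq]⟩
    · refine ⟨e.symm ⟨q, hq⟩, ?_⟩
      simp
  · intro i hi j hj hij
    rw [Finset.mem_coe] at hi hj
    simp only [hi, hj, dif_pos] at hij
    exact congrArg Subtype.val (e.injective (Subtype.ext hij))
  · intro i
    by_cases hi : i ∈ I
    · simpa [hi] using (e ⟨i, hi⟩).2
    · simp [hi]

theorem IsMerge.image_eq {k m : ℕ} {I : Finset (Fin m)} {a : Fin k} {f : Fin m → Fin k}
    (h : IsMerge I a f) : I.image f = Finset.univ.erase a := by
  ext q
  obtain ⟨i, rfl⟩ := h.surjective q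
  rw [h.mem_image_iff, Finset.mem_erase, Ne, h.eq_iff]
  simp

theorem IsMerge.card_image {k m : ℕ} {I : Finset (Fin m)} {a : Fin k} {f : Fin m → Fin k}
    (h : IsMerge I a f) : (I.image f).card = k - 1 := by
  rw [h.image_eq, Finset.card_erase_of_mem (Finset.mem_univ _), Finset.card_univ,
    Fintype.card_fin]

/-- Positive weights on the target of a merge map are sums of positive weights on its source. -/
theorem exists_mergeSum_eq {ι ι' : Type*} [Fintype ι] [DecidableEq ι'] {f : ι → ι'}
    (hf : f.Surjective) {w : ι' → ℝ} (hw : ∀ q, 0 < w q) :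
    ∃ v : ι → ℝ, (∀ i, 0 < v i) ∧ mergeSum f v = w := by
  have hpos : ∀ q, 0 < (Finset.univ.filter fun i => f i = q).card := fun q => by
    obtain ⟨i, hi⟩ := hf q
    exact Finset.card_pos.2 ⟨i, by simp [hi]⟩
  -- Split each weight evenly over its fibre.
  refine ⟨fun i => w (f i) / (Finset.univ.filter fun j => f j = f i).card,
    fun i => div_pos (hw _) (by exact_mod_cast hpos (f i)), ?_⟩
  funext q
  have : ∀ i ∈ Finset.univ.filter (fun i => f i = q),
      w (f i) / ((Finset.univ.filter fun j => f j = f i).card : ℝ) =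
        w q / (Finset.univ.filter fun j => f j = q).card := fun i hi => by
    rw [(Finset.mem_filter.1 hi).2]
  rw [mergeSum, Finset.sum_congr rfl this, Finset.sum_const, nsmul_eq_mul]
  have := (Nat.cast_pos (α := ℝ)).2 (hpos q)
  field_simp

theorem exists_isMerge_image {k m : ℕ} (hk : 1 ≤ k) (hkm : k ≤ m) {I' : Finset (Fin k)}
    (hI' : I'.card = k - 1) : ∃ (I : Finset (Fin m)) (a : Fin k) (f : Fin m → Fin k),
      I.card = k - 1 ∧ IsMerge I a f ∧ I.image f = I' := by
  obtain ⟨a, -, ha⟩ := Finset.exists_mem_notMem_of_card_lt_card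
    (show I'.card < (Finset.univ : Finset (Fin k)).card by
      rw [hI', Finset.card_univ, Fintype.card_fin]; omega)
  obtain ⟨I, -, hI⟩ := Finset.exists_subset_card_eq
    (show k - 1 ≤ (Finset.univ : Finset (Fin m)).card by
      rw [Finset.card_univ, Fintype.card_fin]; omega)
  obtain ⟨f, hf⟩ := exists_isMerge hkm hI a hk
  refine ⟨I, a, f, hI, hf, ?_⟩
  rw [hf.image_eq]
  symm
  refine Finset.eq_of_subset_of_card_le (fun i hi => Finset.mem_erase.2
    ⟨fun h => ha (h ▸ hi), Finset.mem_univ _⟩) ?_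
  rw [Finset.card_erase_of_mem (Finset.mem_univ _), Finset.card_univ, Fintype.card_fin, hI']

theorem contributionConjecture_iff {k m n : ℕ} (hk : 1 ≤ k) (hkm : k ≤ m) (hkn : k ≤ n) :
    ContributionConjecture k m n ↔ ContributionConjecture k k k := by
  constructor
  -- Realise the given square data as the merging of an `m × n` instance, to which the hypothesis
  -- applies.
  · intro h r' c' hr' hc' I' J' hI' hJ'
    obtain ⟨I, a, f, hI, hf, rfl⟩ := exists_isMerge_image hk hkm hI'
    obtain ⟨J, b, g, hJ, hg, rfl⟩ := exists_isMerge_image hk hkn hJ'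
    obtain ⟨r, hr, rfl⟩ := exists_mergeSum_eq hf.surjective hr'
    obtain ⟨c, hc, rfl⟩ := exists_mergeSum_eq hg.surjective hc'
    rw [predictedContribution_mergeSum k hf hg, ← h r c hr hc I J hI hJ, ← mergeSum_mul,
      expectedContribution_mergeSum hk hkm hkn hf hg hI hJ fun p => mul_pos (hr _) (hc _)]
  · intro h r c hr hc I J hI hJ
    obtain ⟨f, hf⟩ := exists_isMerge hkm hI ⟨k - 1, by omega⟩ hk
    obtain ⟨g, hg⟩ := exists_isMerge hkn hJ ⟨k - 1, by omega⟩ hk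
    rw [← predictedContribution_mergeSum k hf hg,
      ← h _ _ (mergeSum_pos hf.surjective hr) (mergeSum_pos hg.surjective hc) _ _
        hf.card_image hg.card_image, ← mergeSum_mul,
      expectedContribution_mergeSum hk hkm hkn hf hg hI hJ fun p => mul_pos (hr _) (hc _)]

end Conjecture

/-! ### The auxiliary matrix as the merging for the leading block. -/

section Leading

variable {k : ℕ}

/-- The indices below `k - 1` stay, and all the others become `k - 1`. -/
def truncate (hk : 1 ≤ k) (m : ℕ) (i : Fin m) : Fin k := ⟨min i (k - 1), by omega⟩

theorem isMerge_truncate (hk : 1 ≤ k) {m : ℕ} (hkm : k ≤ m) :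
    IsMerge (leading k m) ⟨k - 1, by omega⟩ (truncate hk m) := by
  refine ⟨fun q => ⟨Fin.castLE hkm q, ?_⟩, ?_, fun i => ?_⟩
  · ext
    simp only [truncate, Fin.val_castLE]
    omega
  · intro i hi j hj hij
    have := congrArg Fin.val hij
    simp only [leading, Finset.coe_filter, Finset.mem_univ, true_and, Set.mem_ofPred_eq] at hi hj
    simp only [truncate] at this
    ext
    omega
  · simp only [truncate, leading, Fin.ext_iff, Finset.mem_filter, Finset.mem_univ, true_and]
    omega

theorem card_leading {m : ℕ} (hk : 1 ≤ k) (hkm : k ≤ m) : (leading k m).card = k - 1 := by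
  have h := isMerge_truncate hk hkm
  rw [← h.card_image, Finset.card_image_of_injOn h.injOn]

theorem image_truncate_leading {m : ℕ} (hk : 1 ≤ k) (hkm : k ≤ m) :
    (leading k m).image (truncate hk m) = leading k k := by
  rw [(isMerge_truncate hk hkm).image_eq]
  ext q
  simp only [leading, Fin.ext_iff, Finset.mem_filter, Finset.mem_erase, Finset.mem_univ, true_and,
    and_true, Ne]
  omega

theorem mem_mergedInto_iff (hk : 1 ≤ k) {m n : ℕ} (q : Fin k × Fin k) (p : Fin m × Fin n) :
    p ∈ mergedInto m n q ↔ Prod.map (truncate hk m) (truncate hk n) p = q := by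
  simp only [mergedInto, Finset.mem_filter, Finset.mem_univ, true_and, Prod.ext_iff, Fin.ext_iff,
    truncate, Prod.map_fst, Prod.map_snd]

theorem auxMatrix_eq_mergeMin (hk : 1 ≤ k) (m n : ℕ) :
    (auxMatrix k : (Fin m × Fin n → ℝ) → _) =
      mergeMin (Prod.map (truncate hk m) (truncate hk n)) := by
  funext X q
  rw [auxMatrix, mergeMin]
  congr 2
  ext p
  exact mem_mergedInto_iff hk q p

theorem auxRate_eq_mergeSum (hk : 1 ≤ k) {m n : ℕ} (A : Fin m × Fin n → ℝ) :
    auxRate k A = mergeSum (Prod.map (truncate hk m) (truncate hk n)) A := by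
  funext q
  refine Finset.sum_congr ?_ fun _ _ => rfl
  ext p
  rw [mem_mergedInto_iff hk q p]
  simp

end Leading

end RandomAssignment

theorem mainTheorem4 (k m n : ℕ) (hk : 1 ≤ k) (hkm : k ≤ m) (hmn : m ≤ n) :
    (RandomAssignment.ContributionConjecture k m n ↔
      RandomAssignment.ContributionConjecture k k k) ∧
    (∀ A : Fin m × Fin n → ℝ, (∀ p, 0 < A p) →
      (RandomAssignment.expMatrixLaw A).map (RandomAssignment.auxMatrix k) =
        RandomAssignment.expMatrixLaw (RandomAssignment.auxRate k A) ∧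
      RandomAssignment.expectedContribution k A
          (RandomAssignment.leading k m) (RandomAssignment.leading k n) =
        RandomAssignment.expectedContribution k (RandomAssignment.auxRate k A)
          (RandomAssignment.leading k k) (RandomAssignment.leading k k)) := by
  have hkn : k ≤ n := hkm.trans hmn
  have hf := RandomAssignment.isMerge_truncate hk hkm
  have hg := RandomAssignment.isMerge_truncate hk hkn
  refine ⟨RandomAssignment.contributionConjecture_iff hk hkm hkn, fun A hA => ⟨?_, ?_⟩⟩
  · rw [RandomAssignment.auxMatrix_eq_mergeMin hk, RandomAssignment.auxRate_eq_mergeSum hk]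
    exact RandomAssignment.map_mergeMin_pi_expMeasure (hf.surjective.prodMap hg.surjective) hA
  · rw [RandomAssignment.auxRate_eq_mergeSum hk,
      ← RandomAssignment.expectedContribution_mergeSum hk hkm hkn hf hg
        (RandomAssignment.card_leading hk hkm) (RandomAssignment.card_leading hk hkn) hA,
      RandomAssignment.image_truncate_leading hk hkm,
      RandomAssignment.image_truncate_leading hk hkn]
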